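/- Theorem. Let $\mathcal{E}$ be a finite-dimensional Euclidean space of dimension at least $1$ and let $\mathbb{R}_{++}$ be the set of positive reals. For $f\colon\mathcal{E}\to[0,\infty]$ put $$\mathrm{epi}\, f=\{(x,u)\in\mathcal{E}\times\mathbb{R}_{++} : f(x)\le u\},\qquad \mathrm{hypo}\, f=\{(x,u)\in\mathcal{E}\times\mathbb{R}_{++} : f(x)\ge u\}.$$ For a map $G\colon\mathcal{E}\times\mathbb{R}_{++}\to\mathcal{E}\times\mathbb{R}_{++}$ put $$f^G(y)=\sup\{v>0 : (y,v)\in G(\mathrm{epi}\, f)\}\in[0,\infty],\qquad \sup\emptyset=0,$$ and let $f^\Gamma$ be the function obtained in this way from the radial point transformation $\Gamma(x,u)=(x,1)/u$. Let $G$ be a bijection of $\mathcal{E}\times\mathbb{R}_{++}$ onto itself that is - convexity preserving: $G(S)$ is convex for every convex $S\subseteq\mathcal{E}\times\mathbb{R}_{++}$; and - height reversing: if $G(x,u)=(y,v)$, $G(x',u')=(y',v')$ and $u\ge u'$, then $v\le v'$. Then there are an invertible linear map $A\colon\mathcal{E}\to\mathcal{E}$, vectors $\alpha,b\in\mathcal{E}$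 and a number $d>0$ such that $$G(x,u)=\frac{(Ax+\alpha u+b,\ d)}{u}\qquad\text{for all }(x,u)\in\mathcal{E}\times\mathbb{R}_{++}.$$ Furthermore, if $\mathrm{hypo}\,(\ell_+)^G=G(\mathrm{epi}\,\ell_+)$ for every linear $\ell\colon\mathcal{E}\to\mathbb{R}$, where $\ell_+=\max\{\ell,0\}$, then $b=0$ and, for every $f\colon\mathcal{E}\to[0,\infty]$ and every $y\in\mathcal{E}$, $$f^G(y)=d\, f^{\Gamma}\big(A^{-1}(y-\alpha)\big).$$ -/

import Mathlib

open scoped ENNReal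

namespace RadialDuality

variable {E : Type*} [AddCommGroup E] [Module ℝ E]

/-- The open upper half space of `E × ℝ`, i.e. the pairs `(x, u)` with `u > 0`. -/
def upperHalf (E : Type*) : Set (E × ℝ) := {p | 0 < p.2}

/-- Epigraph of a function with values in the extended positive reals, as a subset of
the open upper half space. -/
def epi {E : Type*} (f : E → ℝ≥0∞) : Set (E × ℝ) :=
  {p | 0 < p.2 ∧ f p.1 ≤ ENNReal.ofReal p.2}

/-- Hypograph of a function with values in the extended positive reals, as a subset of
the open upper half space. -/
def hypo {E : Type*} (f : E → ℝ≥0∞) : Set (E × ℝ) :=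
  {p | 0 < p.2 ∧ ENNReal.ofReal p.2 ≤ f p.1}

/-- The function `f^G`, `f^G(y) = sup {v | (y, v) ∈ G (epi f)}`. The supremum is taken in
`[0, ∞]`, so that the supremum of the empty set is `0`. -/
noncomputable def reshape {E : Type*} (G : E × ℝ → E × ℝ) (f : E → ℝ≥0∞) (y : E) : ℝ≥0∞ :=
  ⨆ (v : ℝ) (_ : (y, v) ∈ G '' epi f), ENNReal.ofReal v

/-- The radial point transformation `Γ(x, u) = (x, 1) / u`. -/
noncomputable def radialPoint (p : E × ℝ) : E × ℝ := p.2⁻¹ • (p.1, (1 : ℝ))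

/-- The upper radial function transformation
`f^Γ(y) = sup {v > 0 | (y, v) ∈ Γ (epi f)}`. -/
noncomputable def upperRadial (f : E → ℝ≥0∞) : E → ℝ≥0∞ := reshape radialPoint f

/-- `G` maps convex subsets of the open upper half space to convex sets. -/
def ConvexityPreserving (G : E × ℝ → E × ℝ) : Prop :=
  ∀ S ⊆ upperHalf E, Convex ℝ S → Convex ℝ (G '' S)

/-- On the open upper half space, `u ≥ u'` implies `v ≤ v'`, where `(y, v) = G (x, u)` and
`(y', v') = G (x', u')`. -/
def HeightReversing {E : Type*} (G : E × ℝ → E × ℝ) : Prop :=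
  ∀ p ∈ upperHalf E, ∀ q ∈ upperHalf E, q.2 ≤ p.2 → (G p).2 ≤ (G q).2

/-- `hypo (ℓ₊)^G = G (epi ℓ₊)` for all linear `ℓ : E → ℝ`, where `ℓ₊ = max ℓ 0`. -/
def WellDefinedOnThresholdedLinear (G : E × ℝ → E × ℝ) : Prop :=
  ∀ l : E →ₗ[ℝ] ℝ,
    hypo (reshape G fun x => ENNReal.ofReal (max (l x) 0)) =
      G '' epi (fun x => ENNReal.ofReal (max (l x) 0))

end RadialDuality

/-! Work with the inverse `F` of `G`: since `G` maps the segment `[F a, F b]` to a convex set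
containing `a` and `b`, `F` sends segments into segments. `F` also sends horizontal slices into
horizontal slices: if the image of a slice met two heights, weak height reversal would put the whole
slab between them in that image, which lies in the affine span of `dim E + 1` points, a dimension
too small (`height_eq_of_height_eq`). Hence `F (x, u) = (X x u, σ u)`, and a convex combination of
points at two different heights is mapped with a weight fixed by the heights alone. This makes `X`
affine in `x` with linear parts proportional to one another. Clearing the proportionality factor `b
u` makes `b`, `b * σ` and `b • X 0` affine in `u` (`exists_normal_form`), and since `σ` decreases
onto the positive reals, `b u = u` and `σ u = d / u`. Inverting `F` gives `G`. The translation part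
is excluded by one thresholded linear function whose image has a fibre that is not closed downwards.
-/

namespace RadialDuality

/-! ### Segment preserving maps without continuity assumptions -/

section Segments

variable {V : Type*} [NormedAddCommGroup V] [NormedSpace ℝ V]

/-- An injective map sending segments into segments maps the whole space into every affine subspace
containing the image of an affinely spanning set. -/
theorem mem_affineSubspace_of_segment_preserving [FiniteDimensional ℝ V]
    {W : Type*} [AddCommGroup W] [Module ℝ W] {f : V → W} (hf : Function.Injective f)
    (hseg : ∀ a b, ∀ z ∈ segment ℝ a b, f z ∈ segment ℝ (f a) (f b))
    {S : Set V} (hS : affineSpan ℝ S = ⊤) (M : AffineSubspace ℝ W) (hM : ∀ x ∈ S, f x ∈ M)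
    (z : V) : f z ∈ M := by
  have hconv : Convex ℝ {x | f x ∈ M} := by
    rw [convex_iff_segment_subset]
    intro a ha b hb x hx
    exact M.convex.segment_subset ha hb (hseg a b x hx)
  have hsub : convexHull ℝ S ⊆ {x | f x ∈ M} := convexHull_min hM hconv
  obtain ⟨p, hp⟩ := interior_convexHull_nonempty_iff_affineSpan_eq_top.2 hS
  have hpM : f p ∈ M := hsub (interior_subset hp)
  by_cases hzp : z = p
  · rwa [hzp]
  have hcont : Continuous fun δ : ℝ => p + δ • (p - z) := by fun_prop
  have hev : ∀ᶠ δ in nhdsWithin (0 : ℝ) (Set.Ioi 0), p + δ • (p - z) ∈ convexHull ℝ S := by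
    apply nhdsWithin_le_nhds
    apply hcont.continuousAt.preimage_mem_nhds
    simpa using mem_interior_iff_mem_nhds.1 hp
  -- Go slightly past `p` on the ray from `z`, staying in the hull: `f p` then lies between `f z`
  -- and a second point of `M`, so `f z` is on the line through these two.
  obtain ⟨δ, hδS, hδ⟩ := (hev.and self_mem_nhdsWithin).exists
  have hδ : 0 < δ := hδ
  have hyM : f (p + δ • (p - z)) ∈ M := hsub hδS
  have hy : p + δ • (p - z) ≠ p := by
    intro h
    have h0 : δ • (p - z) = 0 := by simpa using h
    rcases smul_eq_zero.1 h0 with h1 | h1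
    · exact hδ.ne' h1
    · exact hzp (sub_eq_zero.1 h1).symm
  have hmem : p ∈ segment ℝ z (p + δ • (p - z)) := by
    refine ⟨δ / (1 + δ), 1 / (1 + δ), by positivity, by positivity, by field_simp; ring, ?_⟩
    have h1 : (1 + δ) ≠ 0 := by positivity
    match_scalars <;> field_simp
    ring
  have hfp := hseg _ _ p hmem
  rw [segment_eq_image_lineMap] at hfp
  obtain ⟨θ, -, hθ⟩ := hfp
  have hθ1 : 1 - θ ≠ 0 := by
    intro h
    have : θ = 1 := by linarith
    rw [this, AffineMap.lineMap_apply_one] at hθ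
    exact hy (hf hθ)
  have hfz : f z = AffineMap.lineMap (f (p + δ • (p - z))) (f p) (1 / (1 - θ)) := by
    rw [← hθ, AffineMap.lineMap_apply_module, AffineMap.lineMap_apply_module]
    match_scalars <;> field_simp
    ring
  rw [hfz]
  exact AffineMap.lineMap_mem _ hyM hpM

/-- An additive map sending each segment `[0, x]` into `[0, g x]` is linear. -/
theorem map_smul_of_segment_preserving {W : Type*} [NormedAddCommGroup W] [NormedSpace ℝ W]
    (g : V →+ W)
    (hseg : ∀ x, ∀ r ∈ Set.Icc (0 : ℝ) 1, ∃ ρ ∈ Set.Icc (0 : ℝ) 1, g (r • x) = ρ • g x)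
    (t : ℝ) (x : V) : g (t • x) = t • g x := by
  have key : ∀ s : ℝ, 0 ≤ s → g (s • x) = s • g x := by
    intro s hs
    -- Split `n * s` into integer and fractional parts: additivity handles the first exactly, and
    -- the second costs at most `‖g x‖`, uniformly in `n`.
    have hbound : ∀ n : ℕ, n * ‖g (s • x) - s • g x‖ ≤ ‖g x‖ := by
      intro n
      have hr : (n * s - ⌊n * s⌋₊ : ℝ) ∈ Set.Icc (0 : ℝ) 1 :=
        ⟨by linarith [Nat.floor_le (by positivity : 0 ≤ n * s)],
          by linarith [Nat.lt_floor_add_one (n * s)]⟩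
      obtain ⟨ρ, hρ, hgρ⟩ := hseg x _ hr
      have h1 : (n : ℝ) • g (s • x) = (⌊n * s⌋₊ + ρ) • g x := by
        rw [Nat.cast_smul_eq_nsmul, ← map_nsmul, add_smul, ← hgρ, Nat.cast_smul_eq_nsmul,
          ← map_nsmul, ← map_add]
        congr 1
        rw [← Nat.cast_smul_eq_nsmul ℝ n, ← Nat.cast_smul_eq_nsmul ℝ ⌊n * s⌋₊]
        module
      have h2 : (n : ℝ) • (g (s • x) - s • g x) = (ρ - (n * s - ⌊n * s⌋₊)) • g x := by
        rw [smul_sub, h1]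
        module
      have h3 := congrArg norm h2
      rw [norm_smul, norm_smul, Real.norm_natCast] at h3
      rw [h3]
      refine mul_le_of_le_one_left (norm_nonneg _) ?_
      rw [Real.norm_eq_abs, abs_le]
      constructor <;> linarith [hρ.1, hρ.2, hr.1, hr.2]
    by_contra hne
    have hpos : 0 < ‖g (s • x) - s • g x‖ := norm_pos_iff.2 (sub_ne_zero.2 hne)
    obtain ⟨n, hn⟩ := exists_nat_gt (‖g x‖ / ‖g (s • x) - s • g x‖)
    rw [div_lt_iff₀ hpos] at hn
    exact absurd (hbound n) (not_le.2 hn)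
  rcases le_total 0 t with ht | ht
  · exact key t ht
  · have h := key (-t) (by linarith)
    rw [neg_smul, map_neg, neg_smul] at h
    exact neg_injective h

end Segments

/-! ### The inverse map preserves segments and horizontal slices -/

section Inverse

variable {E : Type*} [NormedAddCommGroup E] [NormedSpace ℝ E]

theorem convex_upperHalf : Convex ℝ (upperHalf E) := by
  intro p hp q hq a b ha hb hab
  have hp : 0 < p.2 := hp
  have hq : 0 < q.2 := hq
  change 0 < a * p.2 + b * q.2
  rcases ha.eq_or_lt with rfl | ha
  · have : b = 1 := by linarith
    subst this
    simpa using hq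
  · have := mul_pos ha hp
    have := mul_nonneg hb hq.le
    linarith

/-- The inverse of a convexity preserving bijection sends segments into segments. -/
theorem segment_preserving_of_inverse {G F : E × ℝ → E × ℝ} (hconv : ConvexityPreserving G)
    (hFmaps : Set.MapsTo F (upperHalf E) (upperHalf E))
    (hGF : ∀ p ∈ upperHalf E, G (F p) = p) (hFG : ∀ p ∈ upperHalf E, F (G p) = p)
    {a b : E × ℝ} (ha : a ∈ upperHalf E) (hb : b ∈ upperHalf E) :
    ∀ z ∈ segment ℝ a b, F z ∈ segment ℝ (F a) (F b) := by
  intro z hz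
  have hsub : segment ℝ (F a) (F b) ⊆ upperHalf E :=
    convex_upperHalf.segment_subset (hFmaps ha) (hFmaps hb)
  obtain ⟨p, hp, rfl⟩ := (hconv _ hsub (convex_segment _ _)).segment_subset
    ⟨F a, left_mem_segment _ _ _, hGF a ha⟩ ⟨F b, right_mem_segment _ _ _, hGF b hb⟩ hz
  rwa [hFG p (hsub hp)]

/-- A segment preserving bijection with weakly height reversing inverse maps horizontal slices
into horizontal slices. -/
theorem height_eq_of_height_eq [FiniteDimensional ℝ E] {G F : E × ℝ → E × ℝ}
    (hFmaps : Set.MapsTo F (upperHalf E) (upperHalf E))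
    (hGF : ∀ p ∈ upperHalf E, G (F p) = p) (hFG : ∀ p ∈ upperHalf E, F (G p) = p)
    (hrev : HeightReversing G)
    (hseg : ∀ a ∈ upperHalf E, ∀ b ∈ upperHalf E, ∀ z ∈ segment ℝ a b,
      F z ∈ segment ℝ (F a) (F b))
    {c : ℝ} (hc : 0 < c) (x y : E) : (F (x, c)).2 = (F (y, c)).2 := by
  by_contra hne
  wlog hlt : (F (x, c)).2 < (F (y, c)).2 generalizing x y
  · exact this y x (Ne.symm hne) (lt_of_le_of_ne (not_lt.1 hlt) (Ne.symm hne))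
  have hU : ∀ x : E, (x, c) ∈ upperHalf E := fun x => hc
  set f : E → E × ℝ := fun x => F (x, c) with hf
  have hfinj : Function.Injective f := by
    intro u v huv
    have := congrArg G huv
    simp only [hf, hGF _ (hU _)] at this
    exact (Prod.mk.inj this).1
  have hfseg : ∀ a b, ∀ z ∈ segment ℝ a b, f z ∈ segment ℝ (f a) (f b) := by
    rintro a b z ⟨s, t, hs, ht, hst, rfl⟩
    refine hseg _ (hU a) _ (hU b) _ ⟨s, t, hs, ht, hst, ?_⟩
    ext
    · simp
    · simp [← add_mul, hst]
  -- Height reversal squeezes the height of `G p` between `c` and `c`.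
  have hcover : ∀ p : E × ℝ, (f x).2 ≤ p.2 → p.2 ≤ (f y).2 → ∃ z, f z = p := by
    intro p h1 h2
    have hp : p ∈ upperHalf E := lt_of_lt_of_le (hFmaps (hU x)) h1
    have h3 := hrev p hp _ (hFmaps (hU x)) h1
    have h4 := hrev _ (hFmaps (hU y)) p hp h2
    rw [hGF _ (hU _)] at h3 h4
    refine ⟨(G p).1, ?_⟩
    have : ((G p).1, c) = G p := Prod.ext rfl (le_antisymm h4 h3)
    simp only [hf, this, hFG p hp]
  obtain ⟨B⟩ := AffineBasis.exists_affineBasis_of_finiteDimensional (k := ℝ) (P := E)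
    (ι := Fin (Module.finrank ℝ E + 1)) (by simp)
  have hmem := mem_affineSubspace_of_segment_preserving hfinj hfseg B.tot
    (affineSpan ℝ (Set.range (f ∘ B))) (by
      rintro _ ⟨i, rfl⟩
      exact mem_affineSpan ℝ ⟨i, rfl⟩)
  have hmem' : ∀ p : E × ℝ, (f x).2 ≤ p.2 → p.2 ≤ (f y).2 →
      p ∈ affineSpan ℝ (Set.range (f ∘ B)) := by
    intro p h1 h2
    obtain ⟨z, rfl⟩ := hcover p h1 h2
    exact hmem z
  have htop : vectorSpan ℝ (Set.range (f ∘ B)) = ⊤ := by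
    rw [eq_top_iff]
    rintro ⟨v, r⟩ -
    rw [← direction_affineSpan]
    have h0 := hmem' (0, (f x).2) le_rfl hlt.le
    have h1 := AffineSubspace.vsub_mem_direction (hmem' (v, (f x).2) le_rfl hlt.le) h0
    have h2 := AffineSubspace.vsub_mem_direction (hmem' (0, (f y).2) hlt.le le_rfl) h0
    have h3 := Submodule.add_mem _ h1
      (Submodule.smul_mem _ (r / ((f y).2 - (f x).2)) h2)
    convert h3 using 1
    have : (f y).2 - (f x).2 ≠ 0 := (sub_pos.2 hlt).ne'
    ext
    · simp
    · simp
      field_simp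
  have hle := finrank_vectorSpan_range_le ℝ (f ∘ B) (n := Module.finrank ℝ E) (by simp)
  rw [htop, finrank_top, Module.finrank_prod, Module.finrank_self] at hle
  omega

end Inverse

/-! ### Solving the functional equations for `X` and `σ` -/

section Classification

/-- A function on the positive reals compatible with convex combinations is affine. -/
theorem exists_affine_of_convex_combinations {V : Type*} [AddCommGroup V] [Module ℝ V] {k : ℝ → V}
    (hk : ∀ h c t : ℝ, 0 < h → 0 < c → h ≠ c → t ∈ Set.Icc (0 : ℝ) 1 →
      k ((1 - t) * h + t * c) = (1 - t) • k h + t • k c) :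
    ∃ k₀ k₁ : V, ∀ u : ℝ, 0 < u → k u = k₀ + u • k₁ := by
  -- The line through the values at `1` and `2`; in each case the middle one of `1`, `2`, `u` is a
  -- convex combination of the other two.
  refine ⟨(2 : ℝ) • k 1 - k 2, k 2 - k 1, fun u hu => ?_⟩
  rcases le_or_gt u 2 with h2 | h2
  · rcases le_or_gt 1 u with h1 | h1
    · have h := hk 1 2 (u - 1) one_pos two_pos (by norm_num) ⟨by linarith, by linarith⟩
      rw [show (1 - (u - 1)) * 1 + (u - 1) * 2 = u by ring] at h
      rw [h]
      module
    · have hu2 : 0 < 2 - u := by linarith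
      have h := hk u 2 ((1 - u) / (2 - u)) hu two_pos (by linarith)
        ⟨div_nonneg (by linarith) hu2.le, (div_le_one hu2).2 (by linarith)⟩
      rw [show (1 - (1 - u) / (2 - u)) * u + (1 - u) / (2 - u) * 2 = 1 by field_simp; ring] at h
      rw [h]
      match_scalars <;> field_simp <;> ring
  · have hu1 : 0 < u - 1 := by linarith
    have h := hk 1 u (1 / (u - 1)) one_pos hu (by linarith)
      ⟨by positivity, (div_le_one hu1).2 (by linarith)⟩
    rw [show (1 - 1 / (u - 1)) * 1 + 1 / (u - 1) * u = 2 by field_simp; ring] at h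
    rw [h]
    match_scalars <;> field_simp <;> ring

/-- A strictly decreasing surjection of the positive reals which is a quotient of two positive
affine functions is a multiple of the inversion. -/
theorem fractional_linear_antitone {σ : ℝ → ℝ} {m n p q : ℝ}
    (hpos : ∀ u, 0 < u → 0 < σ u) (hanti : ∀ u v, 0 < u → u < v → σ v < σ u)
    (hsurj : ∀ s, 0 < s → ∃ u, 0 < u ∧ σ u = s)
    (hb : ∀ u, 0 < u → 0 < m + u * n) (hσ : ∀ u, 0 < u → (m + u * n) * σ u = p + u * q) :
    m = 0 ∧ q = 0 ∧ 0 < n ∧ 0 < p := by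
  have nonneg : ∀ m n : ℝ, (∀ u, 0 < u → 0 < m + u * n) → 0 ≤ m ∧ 0 ≤ n := by
    intro m n h
    constructor
    · by_contra! hm
      have h1 := h (-m / (2 * (|n| + 1))) (by have : 0 < -m := by linarith
                                              positivity)
      have h2 : -m / (2 * (|n| + 1)) * n ≤ -m / 2 := by
        rw [div_mul_eq_mul_div, div_le_div_iff₀ (by positivity) two_pos]
        nlinarith [le_abs_self n, abs_nonneg n]
      linarith
    · by_contra! hn
      have h1 := h ((|m| + 1) / (-n)) (by have : 0 < -n := by linarith
                                          positivity)
      have h2 : (|m| + 1) / (-n) * n = -(|m| + 1) := by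
        rw [div_neg, neg_mul, div_mul_cancel₀ _ hn.ne]
      linarith [le_abs_self m]
  obtain ⟨hm, hn⟩ := nonneg m n hb
  obtain ⟨hp, hq⟩ := nonneg p q fun u hu => hσ u hu ▸ mul_pos (hb u hu) (hpos u hu)
  have hdet : q * m < p * n := by
    have h := hanti 1 2 one_pos one_lt_two
    have h1 := hσ 1 one_pos
    have h2 := hσ 2 two_pos
    have b1 := hb 1 one_pos
    have b2 := hb 2 two_pos
    have := mul_lt_mul_of_pos_left h (mul_pos b1 b2)
    nlinarith
  have hpn : 0 < p * n := lt_of_le_of_lt (mul_nonneg hq hm) hdet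
  have hp' : 0 < p := hp.lt_of_ne fun h => by simp [← h] at hpn
  have hn' : 0 < n := hn.lt_of_ne fun h => by simp [← h] at hpn
  refine ⟨?_, ?_, hn', hp'⟩
  -- `p / m` and `q / n` are the limits of `σ` at `0` and at infinity; attaining either contradicts
  -- strict monotonicity (`hdet`) or `0 < p`.
  · by_contra hne
    have hm' : 0 < m := hm.lt_of_ne (Ne.symm hne)
    obtain ⟨u, hu, hs⟩ := hsurj (p / m) (by positivity)
    have h := hσ u hu
    rw [hs] at h
    field_simp at h
    nlinarith
  · by_contra hne
    have hq' : 0 < q := hq.lt_of_ne (Ne.symm hne)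
    obtain ⟨u, hu, hs⟩ := hsurj (q / n) (by positivity)
    have h := hσ u hu
    rw [hs] at h
    field_simp at h
    nlinarith

/-- Classification of the slice preserving, segment preserving, height reversing maps. -/
theorem exists_normal_form {E : Type*} [NormedAddCommGroup E] [NormedSpace ℝ E] [Nontrivial E]
    {X : E → ℝ → E} {σ : ℝ → ℝ}
    (hpos : ∀ u, 0 < u → 0 < σ u) (hanti : ∀ u v, 0 < u → u < v → σ v < σ u)
    (hsurj : ∀ s, 0 < s → ∃ u, 0 < u ∧ σ u = s)
    (hinj : ∀ u, 0 < u → Function.Injective fun x => X x u)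
    (hslice : ∀ u, 0 < u → ∀ a b, ∀ r ∈ Set.Icc (0 : ℝ) 1, ∃ ρ ∈ Set.Icc (0 : ℝ) 1,
      X ((1 - r) • a + r • b) u = (1 - ρ) • X a u + ρ • X b u)
    (hX : ∀ h c t : ℝ, 0 < h → 0 < c → h ≠ c → t ∈ Set.Icc (0 : ℝ) 1 → ∃ θ ∈ Set.Icc (0 : ℝ) 1,
      σ ((1 - t) * h + t * c) = (1 - θ) * σ h + θ * σ c ∧
      ∀ x y, X ((1 - t) • x + t • y) ((1 - t) * h + t * c) = (1 - θ) • X x h + θ • X y c) :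
    ∃ (A : E →ₗ[ℝ] E) (β₀ β₁ : E) (d : ℝ), Function.Injective A ∧ 0 < d ∧
      ∀ u, 0 < u → σ u = d / u ∧ ∀ x, X x u = u⁻¹ • (A x + β₀ + u • β₁) := by
  have hlin : ∀ w, 0 < w → ∃ A : E →ₗ[ℝ] E, ∀ x, X x w = A x + X 0 w := by
    intro w hw
    -- Writing `w` as the midpoint of two different heights splits `X (x + y) w` into a function of
    -- `x` plus a function of `y`.
    obtain ⟨θ, -, -, h⟩ := hX (w / 2) (3 * w / 2) (1 / 2) (by positivity) (by positivity)
      (by linarith) ⟨by norm_num, by norm_num⟩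
    rw [show (1 - 1 / 2) * (w / 2) + 1 / 2 * (3 * w / 2) = w by ring] at h
    have hadd : ∀ x y, X (x + y) w - X 0 w = (X x w - X 0 w) + (X y w - X 0 w) := by
      intro x y
      have e : ∀ x y : E, X (x + y) w =
          (1 - θ) • X ((2 : ℝ) • x) (w / 2) + θ • X ((2 : ℝ) • y) (3 * w / 2) := by
        intro x y
        rw [← h]
        congr 1
        module
      have e1 := e x y
      have e2 := e x 0
      have e3 := e 0 y
      have e4 := e 0 0
      simp only [add_zero, zero_add] at e1 e2 e3 e4
      rw [e1, e2, e3, e4]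
      abel
    let g : E →+ E := AddMonoidHom.mk' (fun x => X x w - X 0 w) hadd
    have hg : ∀ (t : ℝ) x, g (t • x) = t • g x := by
      apply map_smul_of_segment_preserving
      intro x r hr
      obtain ⟨ρ, hρ, e⟩ := hslice w hw 0 x r hr
      refine ⟨ρ, hρ, ?_⟩
      change X (r • x) w - X 0 w = ρ • (X x w - X 0 w)
      rw [smul_zero, zero_add] at e
      rw [e]
      module
    refine ⟨{ g with map_smul' := hg }, fun x => ?_⟩
    change X x w = X x w - X 0 w + X 0 w
    abel
  choose! A hA using hlin
  have hAinj : ∀ w, 0 < w → Function.Injective (A w) := by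
    intro w hw x y hxy
    apply hinj w hw
    change X x w = X y w
    rw [hA w hw x, hA w hw y, hxy]
  obtain ⟨e, he⟩ := exists_ne (0 : E)
  have hne : A 1 e ≠ 0 := fun h => he (hAinj 1 one_pos (by simpa using h))
  have hcomb : ∀ h c t : ℝ, 0 < h → 0 < c → h ≠ c → t ∈ Set.Icc (0 : ℝ) 1 →
      ∃ θ ∈ Set.Icc (0 : ℝ) 1,
      σ ((1 - t) * h + t * c) = (1 - θ) * σ h + θ * σ c ∧
      X 0 ((1 - t) * h + t * c) = (1 - θ) • X 0 h + θ • X 0 c ∧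
      (∀ x, (1 - t) • A ((1 - t) * h + t * c) x = (1 - θ) • A h x) ∧
      ∀ x, t • A ((1 - t) * h + t * c) x = θ • A c x := by
    intro h c t hh hc hhc ht
    obtain ⟨θ, hθ, h1, h2⟩ := hX h c t hh hc hhc ht
    have hw : 0 < (1 - t) * h + t * c := by
      rcases ht.1.eq_or_lt with rfl | h0
      · simpa using hh
      · have := mul_pos h0 hc
        have := mul_nonneg (sub_nonneg.2 ht.2) hh.le
        linarith
    have h3 := h2 0 0
    rw [smul_zero, smul_zero, add_zero] at h3
    refine ⟨θ, hθ, h1, h3, fun x => ?_, fun x => ?_⟩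
    · have h4 := h2 x 0
      rw [hA _ hw, h3, hA h hh x] at h4
      simp only [smul_zero, add_zero, map_smul, smul_add] at h4
      rw [← add_assoc] at h4
      simpa using h4
    · have h4 := h2 0 x
      rw [hA _ hw, h3, hA c hc x] at h4
      simp only [smul_zero, zero_add, map_smul, smul_add] at h4
      rw [add_left_comm] at h4
      simpa using h4
  have hb : ∀ u, 0 < u → ∃ b : ℝ, 0 < b ∧ ∀ x, A 1 x = b • A u x := by
    intro u hu
    by_cases hu1 : u = 1
    · exact ⟨1, one_pos, fun x => by rw [hu1, one_smul]⟩
    -- At the midpoint both left-hand sides agree, so `A 1` and `A u` are proportional.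
    obtain ⟨θ, hθ, -, -, h1, h2⟩ := hcomb 1 u (1 / 2) one_pos hu (Ne.symm hu1)
      ⟨by norm_num, by norm_num⟩
    have h3 : ∀ x, (1 - θ) • A 1 x = θ • A u x := by
      intro x
      rw [← h1, ← h2]
      norm_num
    have hθ1 : 0 < 1 - θ := by
      refine (sub_nonneg.2 hθ.2).lt_of_ne fun h => ?_
      have h4 := h3 e
      rw [← h, zero_smul, show θ = 1 by linarith, one_smul] at h4
      exact he (hAinj u hu (by simpa using h4.symm))
    have h5 : ∀ x, A 1 x = (θ / (1 - θ)) • A u x := by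
      intro x
      rw [div_eq_inv_mul, mul_smul, ← h3, smul_smul, inv_mul_cancel₀ hθ1.ne', one_smul]
    refine ⟨θ / (1 - θ), (div_nonneg hθ.1 hθ1.le).lt_of_ne fun h => ?_, h5⟩
    apply hne
    rw [h5, ← h, zero_smul]
  choose! b hbpos hbA using hb
  have hbcomb : ∀ h c t : ℝ, 0 < h → 0 < c → h ≠ c → t ∈ Set.Icc (0 : ℝ) 1 →
      ∃ θ : ℝ, (1 - t) * b h = (1 - θ) * b ((1 - t) * h + t * c) ∧
        t * b c = θ * b ((1 - t) * h + t * c) ∧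
        σ ((1 - t) * h + t * c) = (1 - θ) * σ h + θ * σ c ∧
        X 0 ((1 - t) * h + t * c) = (1 - θ) • X 0 h + θ • X 0 c := by
    intro h c t hh hc hhc ht
    obtain ⟨θ, hθ, h1, h2, h3, h4⟩ := hcomb h c t hh hc hhc ht
    have hw : 0 < (1 - t) * h + t * c := by
      rcases ht.1.eq_or_lt with rfl | h0
      · simpa using hh
      · have := mul_pos h0 hc
        have := mul_nonneg (sub_nonneg.2 ht.2) hh.le
        linarith
    set w := (1 - t) * h + t * c
    refine ⟨θ, ?_, ?_, h1, h2⟩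
    · apply smul_left_injective ℝ hne
      change ((1 - t) * b h) • A 1 e = ((1 - θ) * b w) • A 1 e
      calc ((1 - t) * b h) • A 1 e = (b h * b w) • ((1 - t) • A w e) := by
            rw [hbA w hw e]; module
        _ = ((1 - θ) * b w) • A 1 e := by rw [h3, hbA h hh e]; module
    · apply smul_left_injective ℝ hne
      change (t * b c) • A 1 e = (θ * b w) • A 1 e
      calc (t * b c) • A 1 e = (b c * b w) • (t • A w e) := by
            rw [hbA w hw e]; module
        _ = (θ * b w) • A 1 e := by rw [h4, hbA c hc e]; module
  -- Adding the two weight identities of `hbcomb` eliminates `θ`.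
  obtain ⟨m, n, hmn⟩ := exists_affine_of_convex_combinations (k := b) (by
    intro h c t hh hc hhc ht
    obtain ⟨θ, h1, h2, -, -⟩ := hbcomb h c t hh hc hhc ht
    simp only [smul_eq_mul]
    linarith)
  obtain ⟨p, q, hpq⟩ := exists_affine_of_convex_combinations (k := fun u => b u * σ u) (by
    intro h c t hh hc hhc ht
    obtain ⟨θ, h1, h2, h3, -⟩ := hbcomb h c t hh hc hhc ht
    simp only [smul_eq_mul]
    rw [h3, ← mul_assoc (1 - t), ← mul_assoc t, h1, h2]
    ring)
  obtain ⟨β₀, β₁, hβ⟩ := exists_affine_of_convex_combinations (k := fun u => b u • X 0 u) (by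
    intro h c t hh hc hhc ht
    obtain ⟨θ, h1, h2, -, h4⟩ := hbcomb h c t hh hc hhc ht
    simp only [smul_smul]
    rw [h4, h1, h2]
    module)
  simp only [smul_eq_mul] at hmn hpq
  obtain ⟨rfl, rfl, hn, hp⟩ := fractional_linear_antitone hpos hanti hsurj
    (fun u hu => hmn u hu ▸ hbpos u hu) (fun u hu => hmn u hu ▸ hpq u hu)
  have hb1 : b 1 = 1 := by
    apply smul_left_injective ℝ hne
    change b 1 • A 1 e = (1 : ℝ) • A 1 e
    rw [← hbA 1 one_pos, one_smul]
  have hn1 : n = 1 := by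
    have := hmn 1 one_pos
    rw [hb1] at this
    linarith
  have hbu : ∀ u, 0 < u → b u = u := by
    intro u hu
    rw [hmn u hu, hn1]
    ring
  refine ⟨A 1, β₀, β₁, p, hAinj 1 one_pos, hp, fun u hu => ⟨?_, fun x => ?_⟩⟩
  · have := hpq u hu
    rw [hbu u hu] at this
    rw [eq_div_iff hu.ne']
    linarith
  · rw [add_assoc, ← hβ u hu, hbA u hu x, hbu u hu, ← smul_add, smul_smul,
      inv_mul_cancel₀ hu.ne', one_smul, hA u hu x]

end Classification

/-! ### Fractional linear form of `G` -/

section NormalForm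

variable {E : Type*} [NormedAddCommGroup E] [NormedSpace ℝ E]

/-- A convexity preserving, height reversing bijection of the upper half space is fractional
linear. -/
theorem exists_fractional_linear [FiniteDimensional ℝ E] [Nontrivial E] {G : E × ℝ → E × ℝ}
    (hbij : Set.BijOn G (upperHalf E) (upperHalf E))
    (hconv : ConvexityPreserving G) (hrev : HeightReversing G) :
    ∃ (A : E ≃ₗ[ℝ] E) (α b : E) (d : ℝ), 0 < d ∧
      ∀ (x : E) (u : ℝ), 0 < u → G (x, u) = u⁻¹ • (A x + u • α + b, d) := by
  set F := Function.invFunOn G (upperHalf E) with hF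
  have hinv : Set.InvOn F G (upperHalf E) (upperHalf E) := hbij.invOn_invFunOn
  have hFG : ∀ p ∈ upperHalf E, F (G p) = p := fun p hp => hinv.1 hp
  have hGF : ∀ p ∈ upperHalf E, G (F p) = p := fun p hp => hinv.2 hp
  have hFmaps : Set.MapsTo F (upperHalf E) (upperHalf E) := hbij.surjOn.mapsTo_invFunOn
  have hFinj : ∀ p ∈ upperHalf E, ∀ q ∈ upperHalf E, F p = F q → p = q := by
    intro p hp q hq h
    rw [← hGF p hp, h, hGF q hq]
  have hseg : ∀ a ∈ upperHalf E, ∀ b ∈ upperHalf E, ∀ z ∈ segment ℝ a b,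
      F z ∈ segment ℝ (F a) (F b) :=
    fun a ha b hb => segment_preserving_of_inverse hconv hFmaps hGF hFG ha hb
  have hheight : ∀ (x : E) (u : ℝ), 0 < u → (F (x, u)).2 = (F (0, u)).2 :=
    fun x u hu => height_eq_of_height_eq hFmaps hGF hFG hrev hseg hu x 0
  have hU : ∀ (x : E) {u : ℝ}, 0 < u → (x, u) ∈ upperHalf E := fun _ _ hu => hu
  have hanti : ∀ u v : ℝ, 0 < u → u < v → (F (0, v)).2 < (F (0, u)).2 := by
    intro u v hu huv
    by_contra! h
    have h1 := hrev _ (hFmaps (hU 0 (hu.trans huv))) _ (hFmaps (hU 0 hu)) h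
    rw [hGF _ (hU 0 hu), hGF _ (hU 0 (hu.trans huv))] at h1
    exact absurd huv (not_lt.2 h1)
  have hcomb : ∀ (x y : E) (h c t : ℝ), 0 < h → 0 < c → t ∈ Set.Icc (0 : ℝ) 1 →
      ∃ θ ∈ Set.Icc (0 : ℝ) 1, F ((1 - t) • x + t • y, (1 - t) * h + t * c) =
        (1 - θ) • F (x, h) + θ • F (y, c) := by
    intro x y h c t hh hc ht
    obtain ⟨r, s, hr, hs, hrs, e⟩ := hseg _ (hU x hh) _ (hU y hc)
      ((1 - t) • x + t • y, (1 - t) * h + t * c)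
      ⟨1 - t, t, sub_nonneg.2 ht.2, ht.1, by ring, by simp⟩
    refine ⟨s, ⟨hs, by linarith⟩, ?_⟩
    rw [← e, ← hrs]
    congr 2
    ring
  obtain ⟨A, β₀, β₁, d, hA, hd, hform⟩ := exists_normal_form
    (X := fun x u => (F (x, u)).1) (σ := fun u => (F (0, u)).2)
    (fun u hu => hFmaps (hU 0 hu)) hanti
    (by
      intro s hs
      have hp : G (0, s) ∈ upperHalf E := hbij.mapsTo (hU 0 hs)
      refine ⟨(G (0, s)).2, hp, ?_⟩
      rw [← hheight (G (0, s)).1 _ hp, Prod.mk.eta, hFG _ (hU 0 hs)])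
    (by
      intro u hu x y hxy
      exact (Prod.mk.inj (hFinj _ (hU x hu) _ (hU y hu)
        (Prod.ext hxy (by rw [hheight x u hu, hheight y u hu])))).1)
    (by
      intro u hu a b r hr
      obtain ⟨ρ, hρ, e⟩ := hcomb a b u u r hu hu hr
      rw [← add_mul, sub_add_cancel, one_mul] at e
      exact ⟨ρ, hρ, congrArg Prod.fst e⟩)
    (by
      intro h c t hh hc hhc ht
      have hw : 0 < (1 - t) * h + t * c := by
        rcases ht.1.eq_or_lt with rfl | h0
        · simpa using hh
        · have := mul_pos h0 hc
          have := mul_nonneg (sub_nonneg.2 ht.2) hh.le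
          linarith
      have hne : (F (0, c)).2 - (F (0, h)).2 ≠ 0 := by
        rcases lt_or_gt_of_ne hhc with hlt | hlt
        · exact (sub_neg.2 (hanti h c hh hlt)).ne
        · exact (sub_pos.2 (hanti c h hc hlt)).ne'
      have hsnd : ∀ x y θ, F ((1 - t) • x + t • y, (1 - t) * h + t * c) =
          (1 - θ) • F (x, h) + θ • F (y, c) → (F (0, (1 - t) * h + t * c)).2 =
            (1 - θ) * (F (0, h)).2 + θ * (F (0, c)).2 := by
        intro x y θ e
        have e2 := congrArg Prod.snd e
        rw [hheight _ _ hw] at e2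
        simpa [hheight x h hh, hheight y c hc] using e2
      obtain ⟨θ, hθ, e⟩ := hcomb 0 0 h c t hh hc ht
      refine ⟨θ, hθ, hsnd _ _ _ e, fun x y => ?_⟩
      obtain ⟨θ', -, e'⟩ := hcomb x y h c t hh hc ht
      have h1 := hsnd _ _ _ e
      have h2 := hsnd _ _ _ e'
      -- The second coordinate determines the weight because the two image heights differ.
      have : θ' = θ := by
        apply mul_right_cancel₀ hne
        linarith
      rw [this] at e'
      exact congrArg Prod.fst e')
  have hFform : ∀ (x : E) (u : ℝ), 0 < u → F (x, u) = (u⁻¹ • (A x + β₀ + u • β₁), d / u) :=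
    fun x u hu => Prod.ext ((hform u hu).2 x) ((hheight x u hu).trans (hform u hu).1)
  let A' := LinearEquiv.ofInjectiveEndo A hA
  -- Obtained by solving `F (x, u) = (y, v)`: `u = d / v` and `A x = u • y - β₀ - u • β₁`.
  refine ⟨A'.symm.trans (LinearEquiv.smulOfNeZero ℝ E d hd.ne'), -A'.symm β₀,
    -(d • A'.symm β₁), d, hd, fun y v hv => ?_⟩
  have hdv : 0 < d / v := by positivity
  have hGform : G (F (v⁻¹ • (d • A'.symm y + v • -A'.symm β₀ + -(d • A'.symm β₁)), d / v)) =
      G (y, v) := by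
    congr 1
    rw [hFform _ _ hdv]
    have hAA : ∀ x, A (A'.symm x) = x := fun x => A'.apply_symm_apply x
    ext
    · simp only [map_smul, map_add, map_neg, hAA]
      match_scalars <;> field_simp
      all_goals ring
    · simp only
      field_simp
  rw [← hGform, hGF _ (hU _ hdv)]
  ext
  · simp
  · simp only [Prod.smul_mk, smul_eq_mul]
    field_simp

end NormalForm

/-! ### The induced transformation of functions -/

section Reshape

variable {E : Type*} [NormedAddCommGroup E] [InnerProductSpace ℝ E]

/-- A fractional linear map that is well defined on thresholded linear functions has no
translation part. -/
theorem translation_eq_zero {G : E × ℝ → E × ℝ} {A : E ≃ₗ[ℝ] E} {α b : E} {d : ℝ} (hd : 0 < d)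
    (hG : ∀ (x : E) (u : ℝ), 0 < u → G (x, u) = u⁻¹ • (A x + u • α + b, d))
    (hwd : WellDefinedOnThresholdedLinear G) : b = 0 := by
  by_contra hb
  have hAb : A.symm b ≠ 0 := by simpa using hb
  obtain ⟨l, hl⟩ : ∃ l : E →ₗ[ℝ] ℝ, l (A.symm b) = 1 :=
    ⟨(‖A.symm b‖ ^ 2)⁻¹ • (innerSL ℝ (A.symm b)).toLinearMap, by
      simp [hAb]⟩
  -- A preimage at height `u` over `α + 2b` has `l x = 2 * u - 1`, which is at most `u` exactly when
  -- `u ≤ 1`, that is, when `v = d / u ≥ d`.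
  have himage : ∀ v : ℝ, 0 < v →
      ((α + (2 : ℝ) • b, v) ∈ G '' epi (fun x => ENNReal.ofReal (max (l x) 0)) ↔ d ≤ v) := by
    intro v hv
    constructor
    · rintro ⟨⟨x, u⟩, ⟨hu, hx⟩, e⟩
      have hu : 0 < u := hu
      have hx : l x ≤ u := (le_max_left _ _).trans ((ENNReal.ofReal_le_ofReal_iff hu.le).1 hx)
      rw [hG x u hu] at e
      have e1 : u⁻¹ • (A x + u • α + b) = α + (2 : ℝ) • b := congrArg Prod.fst e
      have e2 : u⁻¹ * d = v := congrArg Prod.snd e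
      have e3 : A x = (2 * u - 1) • b := by
        have h := congrArg (fun z => u • z) e1
        simp only [smul_smul, mul_inv_cancel₀ hu.ne', one_smul] at h
        have h' : A x = (A x + u • α + b) - u • α - b := by abel
        rw [h', h]
        module
      have e4 : l x = 2 * u - 1 := by
        rw [← A.symm_apply_apply x, e3, map_smul, map_smul, hl, smul_eq_mul, mul_one]
      have hu1 : u ≤ 1 := by linarith
      rw [← e2]
      exact le_mul_of_one_le_left hd.le ((one_le_inv₀ hu).2 hu1)
    · intro hdv
      have hu : 0 < d / v := by positivity
      have hu1 : d / v ≤ 1 := (div_le_one hv).2 hdv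
      refine ⟨((2 * (d / v) - 1) • A.symm b, d / v), ⟨hu, ?_⟩, ?_⟩
      · apply ENNReal.ofReal_le_ofReal
        simp only [map_smul, hl, smul_eq_mul, mul_one]
        exact max_le (by linarith) hu.le
      · rw [hG _ _ hu]
        ext
        · simp only [map_smul, LinearEquiv.apply_symm_apply, Prod.smul_mk]
          match_scalars <;> field_simp
          all_goals ring
        · simp only [Prod.smul_mk, smul_eq_mul]
          field_simp
  -- A hypograph contains everything below `d` in this fibre, whereas the image stops at `d`.
  have hmem : (α + (2 : ℝ) • b, d / 2) ∈ G '' epi (fun x => ENNReal.ofReal (max (l x) 0)) := by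
    rw [← hwd l]
    refine ⟨half_pos hd, ?_⟩
    refine le_trans ?_ (le_iSup₂ (f := fun v _ => ENNReal.ofReal v) d ((himage d hd).2 le_rfl))
    exact ENNReal.ofReal_le_ofReal (half_le_self hd.le)
  have := (himage _ (half_pos hd)).1 hmem
  linarith

/-- The function transformation induced by a fractional linear map without translation part. -/
theorem reshape_eq_upperRadial {G : E × ℝ → E × ℝ} {A : E ≃ₗ[ℝ] E} {α : E} {d : ℝ} (hd : 0 < d)
    (hG : ∀ (x : E) (u : ℝ), 0 < u → G (x, u) = u⁻¹ • (A x + u • α, d)) (f : E → ℝ≥0∞) (y : E) :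
    reshape G f y = ENNReal.ofReal d * upperRadial f (A.symm (y - α)) := by
  have himage : ∀ v : ℝ, (A.symm (y - α), v) ∈ radialPoint '' epi f ↔
      (y, d * v) ∈ G '' epi f := by
    intro v
    have key : ∀ (x : E) (u : ℝ), 0 < u →
        (radialPoint (x, u) = (A.symm (y - α), v) ↔ G (x, u) = (y, d * v)) := by
      intro x u hu
      rw [hG x u hu, radialPoint]
      simp only [Prod.smul_mk, Prod.mk.injEq, smul_eq_mul, mul_one]
      rw [LinearEquiv.eq_symm_apply, map_smul, smul_add, smul_smul, inv_mul_cancel₀ hu.ne',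
        one_smul, eq_sub_iff_add_eq, mul_comm, mul_right_inj' hd.ne']
    constructor
    · rintro ⟨⟨x, u⟩, hxu, e⟩
      exact ⟨(x, u), hxu, (key x u hxu.1).1 e⟩
    · rintro ⟨⟨x, u⟩, hxu, e⟩
      exact ⟨(x, u), hxu, (key x u hxu.1).2 e⟩
  rw [upperRadial, reshape, reshape]
  simp only [ENNReal.mul_iSup, ← ENNReal.ofReal_mul hd.le]
  apply le_antisymm
  · refine iSup₂_le fun v hv => ?_
    have hv' : d * (v / d) = v := by field_simp
    rw [← hv'] at hv ⊢
    exact le_iSup₂ (f := fun w _ => ENNReal.ofReal (d * w)) (v / d) ((himage _).2 hv)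
  · exact iSup₂_le fun v hv =>
      le_iSup₂ (f := fun w _ => ENNReal.ofReal w) (d * v) ((himage v).1 hv)

end Reshape

end RadialDuality

theorem mainTheorem2 {E : Type*} [NormedAddCommGroup E] [InnerProductSpace ℝ E]
    [FiniteDimensional ℝ E] [Nontrivial E] (G : E × ℝ → E × ℝ)
    (hbij : Set.BijOn G (RadialDuality.upperHalf E) (RadialDuality.upperHalf E))
    (hconv : RadialDuality.ConvexityPreserving G)
    (hrev : RadialDuality.HeightReversing G) :
    ∃ (A : E ≃ₗ[ℝ] E) (α b : E) (d : ℝ), 0 < d ∧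
      (∀ (x : E) (u : ℝ), 0 < u → G (x, u) = u⁻¹ • (A x + u • α + b, d)) ∧
      (RadialDuality.WellDefinedOnThresholdedLinear G →
        b = 0 ∧ ∀ (f : E → ℝ≥0∞) (y : E),
          RadialDuality.reshape G f y =
            ENNReal.ofReal d * RadialDuality.upperRadial f (A.symm (y - α))) := by
  obtain ⟨A, α, b, d, hd, hG⟩ := RadialDuality.exists_fractional_linear hbij hconv hrev
  refine ⟨A, α, b, d, hd, hG, fun hwd => ?_⟩
  obtain rfl := RadialDuality.translation_eq_zero hd hG hwd
  simp only [add_zero] at hG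
  exact ⟨rfl, RadialDuality.reshape_eq_upperRadial hd hG⟩
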